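/- Let $\mathrm{Ch}^b(\mathbb Z)$ be the symmetric monoidal exact category of bounded (cohomological) complexes of finitely generated free abelian groups, with the usual tensor product and the degreewise split conflations. Its unit $\mathbf 1$ is $\mathbb Z$ in degree $0$; let $C$ be the complex $\mathbb Z\xrightarrow{\ \mathrm{id}\ }\mathbb Z$ in degrees $-1,0$. Let $\mathcal E$ be a complicial exact category, that is, a (Quillen) exact category equipped with a bi-exact action $\otimes:\mathrm{Ch}^b(\mathbb Z)\times\mathcal E\to\mathcal E$ of this monoidal category. Write $Cx=C\otimes x$; the inclusion $\mathbf 1\to C$ induces an inflation $x\to Cx$. For $f:x\to y$, let $\mathrm{Cone}(f)$ be the pushout of $f$ along $x\to Cx$. A Frobenius inflation is an inflation $x\to y$ along which every map $x\to Cu$ ($u\in\mathcal E$) extends to $y$; a Frobenius deflation is a deflation $x\to y$ along which every map $Cu\to y$ lifts to $x$. An object is projective-injective if it is projective with respect to Frobenius deflations and injective with respect to Frobenius inflations. Two parallel maps are homotopic if their difference factors through a projective-injective object; a map is a homotopy equivalence if it has an inverse up to homotopy. A *class of weak equivalences* is a class $w$ of morphisms of $\mathcal E$ such that * if $f$ is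 a (chain) homotopy equivalence in $\mathrm{Ch}^b(\mathbb Z)$ and $g\in w$, then $f\otimes g\in w$; * every homotopy equivalence of $\mathcal E$ is in $w$; * $w$ has the two-out-of-three property; * if $(a,b,c)$ is a morphism of conflations with $a,c\in w$, then $b\in w$; * $w$ is closed under retracts in the arrow category. A *null class* is an additive full subcategory $\mathcal N$ of $\mathcal E$ (containing $0$ and closed under finite direct sums) such that * every object homotopy equivalent to an object of $\mathcal N$ is in $\mathcal N$; * $a\otimes x\in\mathcal N$ for all $a\in\mathrm{Ch}^b(\mathbb Z)$ and $x\in\mathcal N$; * if $x\to y\to z$ is a conflation in $\mathcal E$ and $x,z\in\mathcal N$, then $y\in\mathcal N$; * if $i:x\to y$, $p:y\to x$ satisfy $pi=\mathrm{id}_x$ and $y\in\mathcal N$, then $x\in\mathcal N$. For a class of weak equivalences $w$ let $\mathcal E^w$ be the class of $w$-trivial objects, i.e. of those $x$ for which $0\to x$ is in $w$. For a null class $\mathcal N$ let $w_{\mathcal N}=\{f\mid \mathrm{Cone}(f)\in\mathcal N\}$. Then: 1. for every class of weak equivalences $w$, $\mathcal E^w$ is a null class; 2. for every null class $\mathcal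 N$, $w_{\mathcal N}$ is a class of weak equivalences; 3. $w\mapsto\mathcal E^w$ and $\mathcal N\mapsto w_{\mathcal N}$ are mutually inverse bijections between the classes of weak equivalences and the null classes of $\mathcal E$: $w_{\mathcal E^w}=w$ and $\mathcal E^{w_{\mathcal N}}=\mathcal N$. -/

import Mathlib

open CategoryTheory Limits MonoidalCategory ZeroObject

noncomputable section

namespace Complicial

instance curriedTensor_obj_preserves (X : ModuleCat.{0} ℤ) :
    PreservesColimitsOfSize.{0, 0} ((curriedTensor (ModuleCat.{0} ℤ)).obj X) :=
  inferInstanceAs (PreservesColimitsOfSize.{0, 0} (tensorLeft X))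

instance curriedTensor_flip_obj_preserves (X : ModuleCat.{0} ℤ) :
    PreservesColimitsOfSize.{0, 0} ((curriedTensor (ModuleCat.{0} ℤ)).flip.obj X) :=
  preservesColimits_of_natIso (BraidedCategory.tensorLeftIsoTensorRight X)

/-- Finitely generated free modules. -/
def IsFreeFinite {R : Type} [CommRing R] (M : ModuleCat.{0} R) : Prop :=
  Module.Free R M ∧ Module.Finite R M

theorem isFreeFinite_of_retract {R : Type} [CommRing R] [IsDomain R] [IsPrincipalIdealRing R]
    {M N : ModuleCat.{0} R} (r : M ⟶ N) (t : N ⟶ M)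
    (h : r ≫ t = 𝟙 M) (hN : IsFreeFinite N) : IsFreeFinite M := by
  obtain ⟨_, _⟩ := hN
  have hl : t.hom ∘ₗ r.hom = LinearMap.id := by
    rw [← ModuleCat.hom_comp, h, ModuleCat.hom_id]
  have : Module.Finite R M := Module.Finite.of_surjective t.hom
    (fun x => ⟨r.hom x, LinearMap.congr_fun hl x⟩)
  have : Module.Free R M := Module.Free.of_equiv
    (LinearEquiv.ofInjective r.hom (fun x y hxy => by
      rw [← LinearMap.id_apply (R := R) x, ← LinearMap.id_apply (R := R) y, ← hl]
      simp [hxy])).symm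
  exact ⟨inferInstance, inferInstance⟩

theorem isFreeFinite_tensor {R : Type} [CommRing R] {M N : ModuleCat.{0} R}
    (hM : IsFreeFinite M) (hN : IsFreeFinite N) : IsFreeFinite (M ⊗ N) := by
  obtain ⟨_, _⟩ := hM
  obtain ⟨_, _⟩ := hN
  exact ⟨inferInstanceAs (Module.Free R (TensorProduct R M N)),
    inferInstanceAs (Module.Finite R (TensorProduct R M N))⟩

theorem isFreeFinite_biproduct {R : Type} [CommRing R] [IsDomain R] [IsPrincipalIdealRing R]
    {ι : Type} [Fintype ι]
    (f : ι → ModuleCat.{0} R) (hf : ∀ i, IsFreeFinite (f i)) :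
    IsFreeFinite (⨁ f : ModuleCat.{0} R) := by
  have := fun i => (hf i).1
  have := fun i => (hf i).2
  exact isFreeFinite_of_retract (ModuleCat.biproductIsoPi f).hom (ModuleCat.biproductIsoPi f).inv
    (by simp) ⟨inferInstanceAs (Module.Free R (∀ i, f i)),
      inferInstanceAs (Module.Finite R (∀ i, f i))⟩

theorem isFreeFinite_int : IsFreeFinite (ModuleCat.of ℤ ℤ) :=
  ⟨inferInstanceAs (Module.Free ℤ ℤ), inferInstanceAs (Module.Finite ℤ ℤ)⟩

/-- Bounded complexes of finitely generated free abelian groups (cohomological grading). -/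
def boundedFree : ObjectProperty (CochainComplex (ModuleCat.{0} ℤ) ℤ) := fun K =>
  (∀ n, IsFreeFinite (K.X n)) ∧ ∃ a b : ℤ, ∀ n, n < a ∨ b < n → IsZero (K.X n)

theorem isZero_tensor {M N : ModuleCat.{0} ℤ} (h : IsZero M ∨ IsZero N) : IsZero (M ⊗ N) := by
  rw [IsZero.iff_id_eq_zero, ← id_whiskerRight]
  rcases h with h | h
  · rw [(IsZero.iff_id_eq_zero M).1 h, MonoidalPreadditive.zero_whiskerRight]
  · rw [id_whiskerRight, ← whiskerLeft_id, (IsZero.iff_id_eq_zero N).1 h, MonoidalPreadditive.whiskerLeft_zero]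

open Classical in
theorem boundedFree_tensor (K L : CochainComplex (ModuleCat.{0} ℤ) ℤ) (hK : boundedFree K)
    (hL : boundedFree L) : boundedFree (K ⊗ L) := by
  obtain ⟨hK, a, b, hab⟩ := hK
  obtain ⟨hL, c, d, hcd⟩ := hL
  refine ⟨fun n => ?_, a + c, b + d, fun n hn => ?_⟩
  · let s := Finset.Icc a b
    let f : s → ModuleCat.{0} ℤ := fun i => K.X i ⊗ L.X (n - i)
    have hf : ∀ i, IsFreeFinite (f i) := fun i => isFreeFinite_tensor (hK i) (hL (n - i))
    let r : (K ⊗ L).X n ⟶ ⨁ f := HomologicalComplex.mapBifunctorDesc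
      (fun i₁ i₂ (h : i₁ + i₂ = n) =>
        if hi : i₁ ∈ s then
          eqToHom (by obtain rfl : i₂ = n - i₁ := by omega
                      rfl) ≫ biproduct.ι f ⟨i₁, hi⟩
        else 0)
    let t : ⨁ f ⟶ (K ⊗ L).X n := biproduct.desc (fun i =>
      HomologicalComplex.ιTensorObj K L i (n - i) n (by omega))
    refine isFreeFinite_of_retract r t ?_ (isFreeFinite_biproduct f hf)
    refine HomologicalComplex.mapBifunctor.hom_ext (F := curriedTensor _) ?_
    intro i₁ i₂ (h : i₁ + i₂ = n)
    obtain rfl : i₂ = n - i₁ := by omega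
    by_cases hi : i₁ ∈ s
    · simp only [r, t, hi, f, HomologicalComplex.ι_mapBifunctorDesc_assoc, dif_pos, eqToHom_refl,
        Category.id_comp, biproduct.ι_desc]
      exact (Category.comp_id _).symm
    · refine (isZero_tensor (Or.inl (hab i₁ ?_))).eq_of_src _ _
      simp only [s, Finset.mem_Icc] at hi
      omega
  · rw [IsZero.iff_id_eq_zero]
    refine HomologicalComplex.mapBifunctor.hom_ext (F := curriedTensor _) ?_
    intro i₁ i₂ (h : i₁ + i₂ = n)
    refine (isZero_tensor ?_).eq_of_src _ _
    by_cases h1 : i₁ < a ∨ b < i₁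
    · exact Or.inl (hab _ h1)
    · exact Or.inr (hcd _ (by omega))

theorem boundedFree_single (n : ℤ) :
    boundedFree ((HomologicalComplex.single (ModuleCat.{0} ℤ) (.up ℤ) n).obj
      (ModuleCat.of ℤ ℤ)) := by
  have hz : ∀ i, i ≠ n → IsZero (((HomologicalComplex.single (ModuleCat.{0} ℤ) (.up ℤ) n).obj
      (ModuleCat.of ℤ ℤ)).X i) := fun i hi => HomologicalComplex.isZero_single_obj_X _ _ _ _ hi
  refine ⟨fun i => ?_, n, n, fun i hi => hz i (by omega)⟩
  refine isFreeFinite_of_retract (N := ModuleCat.of ℤ ℤ) ?_ ?_ ?_ isFreeFinite_int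
  · by_cases hi : i = n
    · exact (HomologicalComplex.singleObjXIsoOfEq _ _ _ _ hi).hom
    · exact 0
  · by_cases hi : i = n
    · exact (HomologicalComplex.singleObjXIsoOfEq _ _ _ _ hi).inv
    · exact 0
  · by_cases hi : i = n
    · simp [hi]
    · exact (hz i hi).eq_of_src _ _

instance : boundedFree.IsMonoidal where
  prop_unit := boundedFree_single 0
  prop_tensor K L hK hL := boundedFree_tensor K L hK hL

/-- The monoidal category of bounded complexes of finitely generated free abelian groups. -/
abbrev ChbZ := boundedFree.FullSubcategory

theorem up_rel : (ComplexShape.up ℤ).Rel (-1) 0 := by simp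

/-- The complex `C`: it is `ℤ` in degrees `-1` and `0`, with differential the identity. -/
def complexC : CochainComplex (ModuleCat.{0} ℤ) ℤ :=
  HomologicalComplex.double (𝟙 (ModuleCat.of ℤ ℤ)) up_rel

theorem complexC_d_zero (j : ℤ) : complexC.d 0 j = 0 :=
  HomologicalComplex.double_d_eq_zero₀ _ up_rel 0 j (by simp)

theorem complexC_d_neg_one (j : ℤ) : complexC.d j (-1) = 0 :=
  HomologicalComplex.double_d_eq_zero₁ _ up_rel j (-1) (by simp)

theorem isZero_complexC_X (i : ℤ) (h₀ : i ≠ -1) (h₁ : i ≠ 0) : IsZero (complexC.X i) :=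
  HomologicalComplex.isZero_double_X _ up_rel i h₀ h₁

theorem boundedFree_complexC : boundedFree complexC := by
  have hz := isZero_complexC_X
  refine ⟨fun i => ?_, -1, 0, fun i hi => hz i (by omega) (by omega)⟩
  refine isFreeFinite_of_retract (N := ModuleCat.of ℤ ℤ) ?_ ?_ ?_ isFreeFinite_int
  · by_cases hi : i = -1
    · subst hi; exact (HomologicalComplex.doubleXIso₀ _ up_rel).hom
    · by_cases hi : i = 0
      · subst hi; exact (HomologicalComplex.doubleXIso₁ _ up_rel (by simp)).hom
      · exact 0
  · by_cases hi : i = -1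
    · subst hi; exact (HomologicalComplex.doubleXIso₀ _ up_rel).inv
    · by_cases hi : i = 0
      · subst hi; exact (HomologicalComplex.doubleXIso₁ _ up_rel (by simp)).inv
      · exact 0
  · by_cases hi : i = -1
    · subst hi; simp [complexC]
    · by_cases hi' : i = 0
      · subst hi'; simp [complexC]
      · exact (hz i hi hi').eq_of_src _ _

/-- `C` as an object of `ChbZ`. -/
def C : ChbZ := ⟨complexC, boundedFree_complexC⟩

/-- `T` is `ℤ` in degree `-1` and zero elsewhere. -/
def T : ChbZ := ⟨(HomologicalComplex.single (ModuleCat.{0} ℤ) (.up ℤ) (-1)).obj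
  (ModuleCat.of ℤ ℤ), boundedFree_single (-1)⟩

/-- The degree `0` part of `C`. -/
def complexCXZero : complexC.X 0 ≅ ModuleCat.of ℤ ℤ :=
  HomologicalComplex.doubleXIso₁ (𝟙 (ModuleCat.of ℤ ℤ)) up_rel (by simp)

/-- The degree `-1` part of `C`. -/
def complexCXNegOne : complexC.X (-1) ≅ ModuleCat.of ℤ ℤ :=
  HomologicalComplex.doubleXIso₀ (𝟙 (ModuleCat.of ℤ ℤ)) up_rel

/-- The map from `ℤ` in degree `0` to `C`, the identity in degree `0`. -/
def singleToComplexC :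
    (HomologicalComplex.single (ModuleCat.{0} ℤ) (.up ℤ) 0).obj (ModuleCat.of ℤ ℤ) ⟶ complexC :=
  HomologicalComplex.mkHomFromSingle complexCXZero.inv
    (fun j _ => by rw [complexC_d_zero, comp_zero])

/-- The map from `C` to `ℤ` in degree `-1`, the identity in degree `-1`. -/
def complexCToSingle :
    complexC ⟶ (HomologicalComplex.single (ModuleCat.{0} ℤ) (.up ℤ) (-1)).obj (ModuleCat.of ℤ ℤ) :=
  HomologicalComplex.mkHomToSingle complexCXNegOne.hom
    (fun j _ => by rw [complexC_d_neg_one, zero_comp])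

theorem isIso_singleToComplexC_f : IsIso (singleToComplexC.f 0) := by
  rw [singleToComplexC, HomologicalComplex.mkHomFromSingle_f]
  infer_instance

theorem isIso_complexCToSingle_f : IsIso (complexCToSingle.f (-1)) := by
  rw [complexCToSingle, HomologicalComplex.mkHomToSingle_f]
  infer_instance

/-- The inclusion `𝟙 ⟶ C`, the identity of `ℤ` in degree `0`. -/
def unitToC : 𝟙_ ChbZ ⟶ C := ObjectProperty.homMk singleToComplexC

/-- The projection `C ⟶ T`, the identity of `ℤ` in degree `-1`. -/
def cToT : C ⟶ T := ObjectProperty.homMk complexCToSingle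

/-- The short complex `𝟙 ⟶ C ⟶ T`. -/
def unitCT : ShortComplex ChbZ where
  X₁ := 𝟙_ ChbZ
  X₂ := C
  X₃ := T
  f := unitToC
  g := cToT
  zero := by
    ext : 1
    refine HomologicalComplex.from_single_hom_ext ?_
    exact (HomologicalComplex.isZero_single_obj_X _ _ _ _ (by simp)).eq_of_tgt _ _

/-- Degree-wise split short complexes: the conflations of the exact structure on `ChbZ`. -/
def degreewiseSplit : ObjectProperty (ShortComplex ChbZ) := fun S =>
  ∀ n : ℤ, Nonempty (S.map (boundedFree.ι ⋙ HomologicalComplex.eval _ _ n)).Splitting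

theorem degreewiseSplit_unitCT : degreewiseSplit unitCT := by
  intro n
  have hU : n ≠ 0 → IsZero ((𝟙_ ChbZ).obj.X n) := fun h =>
    HomologicalComplex.isZero_single_obj_X (.up ℤ) 0 (ModuleCat.of ℤ ℤ) n h
  have hT : n ≠ -1 → IsZero (T.obj.X n) := fun h =>
    HomologicalComplex.isZero_single_obj_X (.up ℤ) (-1) (ModuleCat.of ℤ ℤ) n h
  by_cases h0 : n = 0
  · subst h0
    exact ⟨@ShortComplex.Splitting.ofIsIsoOfIsZero _ _ _ _ isIso_singleToComplexC_f (hT (by simp))⟩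
  · refine ⟨@ShortComplex.Splitting.ofIsZeroOfIsIso _ _ _ _ (hU h0) ?_⟩
    by_cases h1 : n = -1
    · subst h1
      exact isIso_complexCToSingle_f
    · exact ⟨0, (isZero_complexC_X n h1 h0).eq_of_src _ _,
        (hT h1).eq_of_src _ _⟩

/-- Homotopy equivalences of `ChbZ`: homotopy equivalences of cochain complexes. -/
def chHomotopyEquivalences : MorphismProperty ChbZ := fun a b f =>
  ∃ e : HomotopyEquiv a.obj b.obj, e.hom = f.hom

/-! ### Exact categories -/

section Exact

variable {E : Type*} [Category E] [Preadditive E]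

/-- The first maps of the short complexes in a given class. -/
def firstMaps (P : ObjectProperty (ShortComplex E)) : MorphismProperty E := fun _ y i =>
  ∃ (z : E) (p : y ⟶ z) (h : i ≫ p = 0), P (ShortComplex.mk i p h)

/-- The second maps of the short complexes in a given class. -/
def secondMaps (P : ObjectProperty (ShortComplex E)) : MorphismProperty E := fun y _ p =>
  ∃ (x : E) (i : x ⟶ y) (h : i ≫ p = 0), P (ShortComplex.mk i p h)

variable (E) in
/-- A Quillen exact structure on an additive category. -/
class ExactCategory [HasZeroObject E] [HasBinaryBiproducts E] where
  conflation : ObjectProperty (ShortComplex E)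
  conflation_of_iso {S S' : ShortComplex E} (e : S ≅ S') : conflation S → conflation S'
  isKernel {S : ShortComplex E} : conflation S → Nonempty (IsLimit (KernelFork.ofι S.f S.zero))
  isCokernel {S : ShortComplex E} :
    conflation S → Nonempty (IsColimit (CokernelCofork.ofπ S.g S.zero))
  id_inflation (x : E) : firstMaps conflation (𝟙 x)
  id_deflation (x : E) : secondMaps conflation (𝟙 x)
  comp_inflation {x y z : E} (i : x ⟶ y) (j : y ⟶ z) :
    firstMaps conflation i → firstMaps conflation j → firstMaps conflation (i ≫ j)
  comp_deflation {x y z : E} (p : x ⟶ y) (q : y ⟶ z) :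
    secondMaps conflation p → secondMaps conflation q → secondMaps conflation (p ≫ q)
  pushout_inflation {x y x' : E} (i : x ⟶ y) (f : x ⟶ x') : firstMaps conflation i →
    ∃ (y' : E) (f' : y ⟶ y') (i' : x' ⟶ y'), IsPushout f i i' f' ∧ firstMaps conflation i'
  pullback_deflation {y z z' : E} (p : y ⟶ z) (f : z' ⟶ z) : secondMaps conflation p →
    ∃ (y' : E) (f' : y' ⟶ y) (p' : y' ⟶ z'), IsPullback f' p' p f ∧ secondMaps conflation p'

end Exact

/-! ### Complicial exact categories -/

open MonoidalLeftAction

/-- A complicial exact category: an exact category with a bi-exact action of `ChbZ`.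
Exact functors are additive functors that send conflations to conflations. -/
class ComplicialExactCategory (E : Type*) [Category E] [Preadditive E] [HasZeroObject E]
    [HasBinaryBiproducts E] [ExactCategory E] extends MonoidalLeftAction ChbZ E where
  [additive_actionLeft (a : ChbZ) : (actionLeft E a).Additive]
  [additive_actionRight (x : E) : (actionRight ChbZ x).Additive]
  conflation_actionLeft (a : ChbZ) (S : ShortComplex E) : ExactCategory.conflation S →
    ExactCategory.conflation (S.map (actionLeft E a))
  conflation_actionRight (x : E) (S : ShortComplex ChbZ) : degreewiseSplit S →
    ExactCategory.conflation (S.map (actionRight ChbZ x))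

attribute [instance] ComplicialExactCategory.additive_actionLeft
  ComplicialExactCategory.additive_actionRight

section

variable {E : Type*} [Category E] [Preadditive E] [HasZeroObject E] [HasBinaryBiproducts E]
  [ExactCategory E]

/-- Inflations: the first maps of conflations. -/
def IsInflation {x y : E} (i : x ⟶ y) : Prop := firstMaps ExactCategory.conflation i

/-- Deflations: the second maps of conflations. -/
def IsDeflation {x y : E} (p : x ⟶ y) : Prop := secondMaps ExactCategory.conflation p

variable [ComplicialExactCategory E]

/-- The inflation `x ⟶ C ⊗ x`. -/
def toC (x : E) : x ⟶ C ⊙ₗ x := (λₗ[ChbZ] x).inv ≫ unitToC ⊵ₗ x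

theorem isInflation_toC (x : E) : IsInflation (toC x) := by
  have h : unitToC ⊵ₗ x ≫ cToT ⊵ₗ x = 0 := (unitCT.map (actionRight ChbZ x)).zero
  have h' : toC x ≫ cToT ⊵ₗ x = 0 := by rw [toC, Category.assoc, h, comp_zero]
  refine ⟨T ⊙ₗ x, cToT ⊵ₗ x, h', ?_⟩
  refine ExactCategory.conflation_of_iso (S := unitCT.map (actionRight ChbZ x)) ?_
    (ComplicialExactCategory.conflation_actionRight x unitCT degreewiseSplit_unitCT)
  refine ShortComplex.isoMk (λₗ[ChbZ] x) (Iso.refl (C ⊙ₗ x)) (Iso.refl (T ⊙ₗ x)) ?_ ?_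
  · change (λₗ[ChbZ] x).hom ≫ (λₗ[ChbZ] x).inv ≫ unitToC ⊵ₗ x = unitToC ⊵ₗ x ≫ 𝟙 _
    simp
  · change 𝟙 _ ≫ cToT ⊵ₗ x = cToT ⊵ₗ x ≫ 𝟙 _
    simp

instance hasPushout_toC {x y : E} (f : x ⟶ y) : HasPushout f (toC x) := by
  obtain ⟨_, _, _, h, _⟩ := ExactCategory.pushout_inflation (toC x) f (isInflation_toC x)
  exact h.hasPushout

/-- The cone of `f : x ⟶ y`: the pushout of `f` along `x ⟶ C ⊗ x`. -/
def cone {x y : E} (f : x ⟶ y) : E := pushout f (toC x)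

/-- Inflations along which all maps to objects `C ⊗ u` extend. -/
def IsFrobeniusInflation {x y : E} (i : x ⟶ y) : Prop :=
  IsInflation i ∧ ∀ (u : E) (f : x ⟶ C ⊙ₗ u), ∃ g : y ⟶ C ⊙ₗ u, i ≫ g = f

/-- Deflations along which all maps from objects `C ⊗ u` lift. -/
def IsFrobeniusDeflation {x y : E} (p : x ⟶ y) : Prop :=
  IsDeflation p ∧ ∀ (u : E) (f : C ⊙ₗ u ⟶ y), ∃ g : C ⊙ₗ u ⟶ x, g ≫ p = f

/-- The projective-injective objects for the Frobenius exact structure. -/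
def IsProjectiveInjective (q : E) : Prop :=
  (∀ {x y : E} (p : x ⟶ y), IsFrobeniusDeflation p → ∀ f : q ⟶ y, ∃ g : q ⟶ x, g ≫ p = f) ∧
  (∀ {x y : E} (i : x ⟶ y), IsFrobeniusInflation i → ∀ f : x ⟶ q, ∃ g : y ⟶ q, i ≫ g = f)

/-- Two maps are homotopic if their difference factors through a projective-injective object. -/
def Homotopic {x y : E} (f g : x ⟶ y) : Prop :=
  ∃ q : E, IsProjectiveInjective q ∧ ∃ (a : x ⟶ q) (b : q ⟶ y), f - g = a ≫ b

/-- The maps that are invertible up to homotopy. -/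
def homotopyEquivalences (E : Type*) [Category E] [Preadditive E] [HasZeroObject E]
    [HasBinaryBiproducts E] [ExactCategory E] [ComplicialExactCategory E] :
    MorphismProperty E := fun x y f =>
  ∃ g : y ⟶ x, Homotopic (f ≫ g) (𝟙 x) ∧ Homotopic (g ≫ f) (𝟙 y)

/-- Classes of weak equivalences: compatible with the action, containing the homotopy equivalences,
with the two-out-of-three property, closed under extensions and under retracts (in the arrow
category). -/
structure IsClassOfWeakEquivalences (w : MorphismProperty E) : Prop where
  tensor {a b : ChbZ} {x y : E} (f : a ⟶ b) (g : x ⟶ y) :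
    chHomotopyEquivalences f → w g → w (f ⊙ₗₘ g)
  homotopyEquivalences_le : homotopyEquivalences E ≤ w
  twoOutOfThree : w.HasTwoOutOfThreeProperty
  extension {S S' : ShortComplex E} (φ : S ⟶ S') : ExactCategory.conflation S →
    ExactCategory.conflation S' → w φ.τ₁ → w φ.τ₃ → w φ.τ₂
  retract : w.IsStableUnderRetracts

/-- Null classes: additive full subcategories that are closed under homotopy equivalences, the
action of `ChbZ`, extensions and retracts. -/
structure IsNullClass (N : ObjectProperty E) : Prop where
  zero : N 0
  biprod {x y : E} : N x → N y → N (x ⊞ y)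
  homotopyEquivalent {x y : E} (f : x ⟶ y) : homotopyEquivalences E f → N x → N y
  tensor (a : ChbZ) {x : E} : N x → N (a ⊙ₗ x)
  extension {S : ShortComplex E} : ExactCategory.conflation S → N S.X₁ → N S.X₃ → N S.X₂
  retract {x y : E} (i : x ⟶ y) (p : y ⟶ x) : i ≫ p = 𝟙 x → N y → N x

/-- The `w`-trivial objects: those `x` with `0 ⟶ x` in `w`. -/
def trivialObjects (w : MorphismProperty E) : ObjectProperty E := fun x => w (0 : (0 : E) ⟶ x)

/-- The maps with cone in `N`. -/
def coneIn (N : ObjectProperty E) : MorphismProperty E := fun _ _ f => N (cone f)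

end

end Complicial

end

/-!
A morphism `f : x ⟶ y` fits into the conflation `x ⟶ y ⊞ (C ⊗ x) ⟶ cone f` and into a morphism of
conflations from `x ⟶ C ⊗ x ⟶ T ⊗ x` to `y ⟶ cone f ⟶ T ⊗ x`. As `C ⊗ x` is contractible, closure
under extensions, applied to these conflations, shows that a class of weak equivalences contains `f`
if and only if `cone f` is trivial.

For a null class `N`, the maps with cone in `N` have the required properties for three reasons.
* A null-homotopic chain map extends along every degreewise split monomorphism, so chain homotopies
  become homotopies of `E`, and a null-homotopic map out of `x` factors through `x ⟶ C ⊗ x`; hence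
  the cone of a homotopy equivalence is contractible.
* By extensions and rotation, `N` contains the cokernel of a Frobenius inflation between objects of
  `N`; since `T` is invertible, another rotation gives kernels as well. With the octahedron
  `cone f ⟶ cone (f ≫ g) ⟶ cone g` this is the two-out-of-three property.
* By the `3 × 3` lemma, the cones of a morphism of conflations form a conflation.
-/

noncomputable section

namespace Complicial

/-! ### Complexes -/

section Complexes

open HomologicalComplex

section

variable {K K' : CochainComplex (ModuleCat.{0} ℤ) ℤ} (f : K ⟶ K')
  (L : CochainComplex (ModuleCat.{0} ℤ) ℤ)

theorem ιTensorObj_comp_whiskerRight_f (i j n : ℤ) (h : i + j = n) :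
    ιTensorObj K L i j n h ≫ (f ▷ L).f n = f.f i ▷ L.X j ≫ ιTensorObj K' L i j n h :=
  (ι_mapBifunctorMap f (𝟙 L) (curriedTensor _) (.up ℤ) i j n h).trans (by simp)

theorem isSplitMono_whiskerRight_f [∀ i, IsSplitMono (f.f i)] (n : ℤ) :
    IsSplitMono ((f ▷ L).f n) := by
  refine .mk' ⟨mapBifunctorDesc (F := curriedTensor _) fun i j h =>
    retraction (f.f i) ▷ L.X j ≫ ιTensorObj K L i j n h, ?_⟩
  refine mapBifunctor.hom_ext (F := curriedTensor _) fun i j h => ?_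
  have hr : f.f i ▷ L.X j ≫ retraction (f.f i) ▷ L.X j = 𝟙 _ := by
    rw [← comp_whiskerRight, IsSplitMono.id, id_whiskerRight]
  have hι := ιTensorObj_comp_whiskerRight_f f L i j n h
  erw [reassoc_of% hι, ι_mapBifunctorDesc, reassoc_of% hr]
  exact (Category.comp_id _).symm

end

theorem exists_extension_of_homotopy_zero {V ι : Type*} [Category V] [Preadditive V]
    {c : ComplexShape ι} {K L M : HomologicalComplex V c} (i : K ⟶ L)
    [∀ n, IsSplitMono (i.f n)] {f : K ⟶ M} (H : Homotopy f 0) : ∃ g : L ⟶ M, i ≫ g = f := by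
  refine ⟨Homotopy.nullHomotopicMap fun m n => retraction (i.f m) ≫ H.hom m n, ?_⟩
  rw [Homotopy.comp_nullHomotopicMap]
  ext n
  simp only [IsSplitMono.id_assoc]
  simp [Homotopy.nullHomotopicMap, H.comm n]

instance isSplitMono_unitToC_f (n : ℤ) : IsSplitMono (unitToC.hom.f n) :=
  have ⟨s⟩ := degreewiseSplit_unitCT n
  s.isSplitMono_f

theorem complexC_d : complexC.d (-1) 0 = complexCXNegOne.hom ≫ complexCXZero.inv := by
  have := HomologicalComplex.double_d (𝟙 (ModuleCat.of ℤ ℤ)) up_rel (by simp)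
  rwa [Category.id_comp] at this

instance : IsIso (complexC.d (-1) 0) := by
  rw [complexC_d]
  infer_instance

open Classical in
/-- The contraction of `C`: the homotopy from the identity to zero that inverts the
differential. -/
def homotopyIdComplexC : Homotopy (𝟙 complexC) 0 where
  hom i j := if h : i = 0 ∧ j = -1 then
    eqToHom (by rw [h.1]) ≫ inv (complexC.d (-1) 0) ≫ eqToHom (by rw [h.2]) else 0
  zero i j hij := dif_neg (by rintro ⟨rfl, rfl⟩; simp at hij)
  comm n := by
    by_cases h₀ : n = 0
    · subst h₀
      rw [dNext_eq _ (show (ComplexShape.up ℤ).Rel 0 1 from rfl), prevD_eq _ up_rel]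
      simp
    by_cases h₁ : n = -1
    · subst h₁
      rw [dNext_eq _ up_rel, prevD_eq _ (show (ComplexShape.up ℤ).Rel (-2) (-1) from rfl)]
      simp
    · exact (isZero_complexC_X n h₁ h₀).eq_of_src _ _

theorem exists_unitToC_whiskerRight_comp_eq {a b : ChbZ} {f : a ⟶ b} (H : Homotopy f.hom 0) :
    ∃ g : C ⊗ a ⟶ b, unitToC ▷ a ≫ g = (λ_ a).hom ≫ f := by
  have (n : ℤ) : IsSplitMono ((unitToC ▷ a).hom.f n) :=
    isSplitMono_whiskerRight_f unitToC.hom a.obj n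
  have H' : Homotopy ((λ_ a).hom ≫ f).hom 0 := (H.compLeft (λ_ a).hom.hom).trans (.ofEq comp_zero)
  obtain ⟨g, hg⟩ := exists_extension_of_homotopy_zero (unitToC ▷ a).hom H'
  exact ⟨ObjectProperty.homMk g, by ext1; exact hg⟩

section

variable (M N : ModuleCat.{0} ℤ) (i j n : ℤ)

theorem isZero_single_tensor_single_X (h : i + j ≠ n) :
    IsZero (((single (ModuleCat.{0} ℤ) (.up ℤ) i).obj M ⊗
      (single (ModuleCat.{0} ℤ) (.up ℤ) j).obj N).X n) := by
  rw [IsZero.iff_id_eq_zero]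
  refine mapBifunctor.hom_ext (F := curriedTensor _) fun p q (hpq : p + q = n) => ?_
  refine (isZero_tensor ?_).eq_of_src _ _
  by_cases hp : p = i
  · exact .inr (isZero_single_obj_X _ _ _ _ (by omega))
  · exact .inl (isZero_single_obj_X _ _ _ _ hp)

/-- The tensor product of two complexes concentrated in single degrees retracts onto the expected
complex concentrated in a single degree. -/
def singleTensorRetract (h : i + j = n) : Retract
    ((single (ModuleCat.{0} ℤ) (.up ℤ) n).obj (M ⊗ N))
    ((single (ModuleCat.{0} ℤ) (.up ℤ) i).obj M ⊗ (single (ModuleCat.{0} ℤ) (.up ℤ) j).obj N) where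
  i := mkHomFromSingle
    (((singleObjXSelf _ i M).inv ⊗ₘ (singleObjXSelf _ j N).inv) ≫ ιTensorObj _ _ i j n h)
    fun k hk => (isZero_single_tensor_single_X M N i j k
      (by rintro rfl; simp_all)).eq_of_tgt _ _
  r := mkHomToSingle
    (mapBifunctorDesc (F := curriedTensor _) fun p q (hpq : p + q = n) =>
      if hp : p = i then
        (singleObjXIsoOfEq _ i M p hp).hom ⊗ₘ (singleObjXIsoOfEq _ j N q (by omega)).hom
      else 0)
    fun k hk => (isZero_single_tensor_single_X M N i j k
      (by rintro rfl; simp_all)).eq_of_src _ _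
  retract := by
    refine from_single_hom_ext ?_
    rw [comp_f, mkHomFromSingle_f, mkHomToSingle_f]
    simp only [Category.assoc]
    erw [ι_mapBifunctorDesc_assoc]
    simp [singleObjXSelf]

end

/-- `T⁻¹` is `ℤ` in degree `1` and zero elsewhere, an inverse of `T` for the tensor product. -/
def TInv : ChbZ := ⟨(single (ModuleCat.{0} ℤ) (.up ℤ) 1).obj (ModuleCat.of ℤ ℤ),
  boundedFree_single 1⟩

/-- The invertibility of `T`, encoded as a retraction of `T⁻¹ ⊗ T` onto the unit. -/
def unitRetract : Retract (𝟙_ ChbZ) (TInv ⊗ T) :=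
  let r := (Retract.ofIso ((single _ (.up ℤ) 0).mapIso (λ_ (𝟙_ (ModuleCat.{0} ℤ))).symm)).trans
    (singleTensorRetract (.of ℤ ℤ) (.of ℤ ℤ) 1 (-1) 0 (by simp))
  { i := ObjectProperty.homMk r.i
    r := ObjectProperty.homMk r.r
    retract := by ext1; exact r.retract }

end Complexes

/-! ### Exact categories -/

section Biproducts

variable {E : Type*} [Category E] [Preadditive E] [HasBinaryBiproducts E]

theorem isPushout_inl_biprod_map {x y : E} (i : x ⟶ y) (w : E) :
    IsPushout (biprod.inl : x ⟶ x ⊞ w) i (biprod.map i (𝟙 w)) biprod.inl :=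
  ⟨⟨by simp⟩, ⟨PushoutCocone.IsColimit.mk _
    (fun s => biprod.desc s.inr (biprod.inr ≫ s.inl))
    (fun s => by ext <;> simp [s.condition]) (fun s => by simp)
    (fun s m h₁ h₂ => by ext <;> simp [← h₁, ← h₂])⟩⟩

theorem isPushout_inr_biprod_map {x y : E} (i : x ⟶ y) (w : E) :
    IsPushout (biprod.inr : x ⟶ w ⊞ x) i (biprod.map (𝟙 w) i) biprod.inr :=
  ⟨⟨by simp⟩, ⟨PushoutCocone.IsColimit.mk _
    (fun s => biprod.desc (biprod.inl ≫ s.inl) s.inr)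
    (fun s => by ext <;> simp [s.condition]) (fun s => by simp)
    (fun s m h₁ h₂ => by ext <;> simp [← h₁, ← h₂])⟩⟩

end Biproducts

section ExactCategory

variable {E : Type*} [Category E] [Preadditive E] [HasZeroObject E] [HasBinaryBiproducts E]
  [ExactCategory E]

/-- `x ⟶ y ⟶ z` is a conflation. Unlike `ExactCategory.conflation`, this takes the two maps
separately, the vanishing of their composition being part of the assertion. -/
def IsConflation {x y z : E} (i : x ⟶ y) (p : y ⟶ z) : Prop :=
  ∃ h : i ≫ p = 0, ExactCategory.conflation (ShortComplex.mk i p h)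

namespace IsConflation

variable {x y z : E} {i : x ⟶ y} {p : y ⟶ z}

theorem of_shortComplex {S : ShortComplex E} (h : ExactCategory.conflation S) :
    IsConflation S.f S.g := ⟨S.zero, h⟩

theorem isInflation (h : IsConflation i p) : IsInflation i := ⟨z, p, h.1, h.2⟩

theorem isDeflation (h : IsConflation i p) : IsDeflation p := ⟨x, i, h.1, h.2⟩

theorem zero (h : IsConflation i p) : i ≫ p = 0 := h.1

theorem mono (h : IsConflation i p) : Mono i :=
  have ⟨l⟩ := ExactCategory.isKernel h.2
  mono_of_isLimit_fork l

theorem epi (h : IsConflation i p) : Epi p :=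
  have ⟨l⟩ := ExactCategory.isCokernel h.2
  epi_of_isColimit_cofork l

theorem exists_lift (h : IsConflation i p) {t : E} (f : t ⟶ y) (hf : f ≫ p = 0) :
    ∃ g : t ⟶ x, g ≫ i = f :=
  have ⟨l⟩ := ExactCategory.isKernel h.2
  have g := KernelFork.IsLimit.lift' l f hf
  ⟨g.1, g.2⟩

theorem exists_desc (h : IsConflation i p) {t : E} (f : y ⟶ t) (hf : i ≫ f = 0) :
    ∃ g : z ⟶ t, p ≫ g = f :=
  have ⟨l⟩ := ExactCategory.isCokernel h.2
  have g := CokernelCofork.IsColimit.desc' l f hf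
  ⟨g.1, g.2⟩

theorem exists_section (h : IsConflation i p) {r : y ⟶ x} (hr : i ≫ r = 𝟙 x) :
    ∃ s : z ⟶ y, s ≫ p = 𝟙 z := by
  have := h.epi
  obtain ⟨s, hs⟩ := h.exists_desc (𝟙 y - r ≫ i)
    (by rw [Preadditive.comp_sub, reassoc_of% hr, Category.comp_id, sub_self])
  refine ⟨s, ?_⟩
  rw [← cancel_epi p, reassoc_of% hs, Preadditive.sub_comp, Category.assoc, h.zero, comp_zero,
    sub_zero, Category.id_comp, Category.comp_id]

theorem of_iso (h : IsConflation i p) {x' y' z' : E} {i' : x' ⟶ y'} {p' : y' ⟶ z'}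
    (e₁ : x ≅ x') (e₂ : y ≅ y') (e₃ : z ≅ z') (comm₁ : e₁.hom ≫ i' = i ≫ e₂.hom)
    (comm₂ : e₂.hom ≫ p' = p ≫ e₃.hom) : IsConflation i' p' := by
  have w : i' ≫ p' = 0 := by
    rw [← cancel_epi e₁.hom, reassoc_of% comm₁, comm₂, reassoc_of% h.zero, zero_comp, comp_zero]
  exact ⟨w, ExactCategory.conflation_of_iso (ShortComplex.isoMk e₁ e₂ e₃ comm₁ comm₂) h.2⟩

theorem of_isInflation (hi : IsInflation i) {w : i ≫ p = 0}
    (hp : IsColimit (CokernelCofork.ofπ p w)) : IsConflation i p := by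
  obtain ⟨z', p', w', h⟩ := hi
  obtain ⟨l⟩ := ExactCategory.isCokernel h
  exact of_iso ⟨w', h⟩ (Iso.refl _) (Iso.refl _) (l.coconePointUniqueUpToIso hp) (by simp)
    ((Category.id_comp p).trans (l.comp_coconePointUniqueUpToIso_hom hp .one).symm)

theorem of_isDeflation (hp : IsDeflation p) {w : i ≫ p = 0}
    (hi : IsLimit (KernelFork.ofι i w)) : IsConflation i p := by
  obtain ⟨x', i', w', h⟩ := hp
  obtain ⟨l⟩ := ExactCategory.isKernel h
  exact of_iso ⟨w', h⟩ (l.conePointUniqueUpToIso hi) (Iso.refl _) (Iso.refl _)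
    ((l.conePointUniqueUpToIso_hom_comp hi .zero).trans (Category.comp_id i').symm) (by simp)

theorem zero_id (x : E) {z : E} (hz : IsZero z) : IsConflation (0 : z ⟶ x) (𝟙 x) :=
  of_isDeflation (w := zero_comp) (ExactCategory.id_deflation x)
    (KernelFork.IsLimit.ofMonoOfIsZero _ inferInstance hz)

theorem id_zero (x : E) {z : E} (hz : IsZero z) : IsConflation (𝟙 x) (0 : x ⟶ z) :=
  of_isInflation (w := comp_zero) (ExactCategory.id_inflation x)
    (CokernelCofork.IsColimit.ofEpiOfIsZero _ inferInstance hz)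

end IsConflation

theorem isInflation_of_isIso {x y : E} (f : x ⟶ y) [IsIso f] : IsInflation f :=
  ((IsConflation.id_zero x (isZero_zero E)).of_iso (p' := 0) (Iso.refl x) (asIso f) (Iso.refl 0)
    (by simp) (by simp)).isInflation

theorem isDeflation_of_isIso {x y : E} (f : x ⟶ y) [IsIso f] : IsDeflation f :=
  ((IsConflation.zero_id y (isZero_zero E)).of_iso (i' := 0) (Iso.refl 0) (asIso f).symm
    (Iso.refl y) (by simp) (by simp)).isDeflation

theorem IsInflation.comp {x y z : E} {i : x ⟶ y} {j : y ⟶ z} (hi : IsInflation i)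
    (hj : IsInflation j) : IsInflation (i ≫ j) :=
  ExactCategory.comp_inflation i j hi hj

theorem IsDeflation.comp {x y z : E} {p : x ⟶ y} {q : y ⟶ z} (hp : IsDeflation p)
    (hq : IsDeflation q) : IsDeflation (p ≫ q) :=
  ExactCategory.comp_deflation p q hp hq

theorem IsInflation.of_isPushout {x y x' y' : E} {f : x ⟶ x'} {i : x ⟶ y} {i' : x' ⟶ y'}
    {f' : y ⟶ y'} (hi : IsInflation i) (sq : IsPushout f i i' f') : IsInflation i' := by
  obtain ⟨_, _, i₀, sq₀, h₀⟩ := ExactCategory.pushout_inflation i f hi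
  rw [← sq₀.inl_isoIsPushout_hom _ _ sq]
  exact IsInflation.comp h₀ (isInflation_of_isIso _)

theorem IsDeflation.of_isPullback {y z y' z' : E} {f : z' ⟶ z} {p : y ⟶ z} {p' : y' ⟶ z'}
    {f' : y' ⟶ y} (hp : IsDeflation p) (sq : IsPullback f' p' p f) : IsDeflation p' := by
  obtain ⟨_, _, p₀, sq₀, h₀⟩ := ExactCategory.pullback_deflation p f hp
  rw [← sq.isoIsPullback_hom_snd _ _ sq₀]
  exact IsDeflation.comp (isDeflation_of_isIso _) h₀

namespace IsConflation

variable {x y z : E} {i : x ⟶ y} {p : y ⟶ z}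

theorem exists_of_isPushout (h : IsConflation i p) {x' y' : E} {f : x ⟶ x'} {i' : x' ⟶ y'}
    {f' : y ⟶ y'} (sq : IsPushout f i i' f') :
    ∃ p' : y' ⟶ z, IsConflation i' p' ∧ f' ≫ p' = p := by
  have hw : f ≫ 0 = i ≫ p := by rw [comp_zero, h.zero]
  have := h.epi
  have : Epi (sq.desc 0 p hw) := epi_of_epi_fac (sq.inr_desc _ _ hw)
  refine ⟨sq.desc 0 p hw, of_isInflation (h.isInflation.of_isPushout sq) (w := sq.inl_desc _ _ _)
    (CokernelCofork.IsColimit.ofπ' _ _ fun k hk => ?_), sq.inr_desc _ _ _⟩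
  have hg := h.exists_desc (f' ≫ k) (by rw [← sq.w_assoc, hk, comp_zero])
  exact ⟨hg.choose, sq.hom_ext (by rw [sq.inl_desc_assoc, zero_comp, hk])
    (by rw [sq.inr_desc_assoc, hg.choose_spec])⟩

theorem exists_of_isPullback (h : IsConflation i p) {y' z' : E} {f : z' ⟶ z} {p' : y' ⟶ z'}
    {f' : y' ⟶ y} (sq : IsPullback f' p' p f) :
    ∃ i' : x ⟶ y', IsConflation i' p' ∧ i' ≫ f' = i := by
  have hw : i ≫ p = 0 ≫ f := by rw [zero_comp, h.zero]
  have := h.mono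
  have : Mono (sq.lift i 0 hw) := mono_of_mono_fac (sq.lift_fst _ _ hw)
  refine ⟨sq.lift i 0 hw, of_isDeflation (h.isDeflation.of_isPullback sq) (w := sq.lift_snd _ _ _)
    (KernelFork.IsLimit.ofι' _ _ fun k hk => ?_), sq.lift_fst _ _ _⟩
  have hg := h.exists_lift (k ≫ f') (by rw [Category.assoc, sq.w, reassoc_of% hk, zero_comp])
  exact ⟨hg.choose, sq.hom_ext (by rw [Category.assoc, sq.lift_fst, hg.choose_spec])
    (by rw [Category.assoc, sq.lift_snd, comp_zero, hk])⟩

theorem inl_snd (x z : E) : IsConflation (biprod.inl : x ⟶ x ⊞ z) biprod.snd :=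
  of_isInflation ((zero_id z (isZero_zero E)).isInflation.of_isPushout (.of_has_biproduct x z))
    (w := biprod.inl_snd) (biprod.isCokernelInlCokernelFork x z)

end IsConflation

theorem IsInflation.biprod_map {x y x' y' : E} {i : x ⟶ y} {i' : x' ⟶ y'} (hi : IsInflation i)
    (hi' : IsInflation i') : IsInflation (biprod.map i i') := by
  have h := (hi.of_isPushout (isPushout_inl_biprod_map i x')).comp
    (hi'.of_isPushout (isPushout_inr_biprod_map i' y))
  rwa [show biprod.map i (𝟙 x') ≫ biprod.map (𝟙 y) i' = biprod.map i i' by ext <;> simp] at h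

theorem IsInflation.biprod_lift_neg {x y w : E} {i : x ⟶ y} (hi : IsInflation i) (f : x ⟶ w) :
    IsInflation (biprod.lift f (-i)) := by
  let s : w ⊞ x ⟶ w ⊞ x := biprod.desc biprod.inl (biprod.lift f (-𝟙 x))
  have hs : s ≫ s = 𝟙 _ := by ext <;> simp [s]
  have : IsIso s := ⟨s, hs, hs⟩
  have h : IsInflation (biprod.inr ≫ s ≫ biprod.map (𝟙 w) i) :=
    ((IsConflation.zero_id w (isZero_zero E)).isInflation.of_isPushout
      (IsPushout.of_has_biproduct w x).flip).comp
      ((isInflation_of_isIso s).comp (hi.of_isPushout (isPushout_inr_biprod_map i w)))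
  rwa [show biprod.inr ≫ s ≫ biprod.map (𝟙 w) i = biprod.lift f (-i) by ext <;> simp [s]] at h

namespace IsConflation

variable {x y z x' y' z' : E} {i : x ⟶ y} {p : y ⟶ z} {i' : x' ⟶ y'} {p' : y' ⟶ z'}

theorem biprod_map (h : IsConflation i p) (h' : IsConflation i' p') :
    IsConflation (biprod.map i i') (biprod.map p p') := by
  have := h.epi
  have := h'.epi
  refine of_isInflation (h.isInflation.biprod_map h'.isInflation)
    (w := by ext <;> simp [h.zero, h'.zero])
    (CokernelCofork.IsColimit.ofπ' _ _ fun k hk => ?_)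
  have hg := h.exists_desc (biprod.inl ≫ k)
    (by simpa only [biprod.inl_map_assoc, comp_zero] using biprod.inl ≫= hk)
  have hg' := h'.exists_desc (biprod.inr ≫ k)
    (by simpa only [biprod.inr_map_assoc, comp_zero] using biprod.inr ≫= hk)
  exact ⟨biprod.desc hg.choose hg'.choose,
    by ext <;> simp [hg.choose_spec, hg'.choose_spec]⟩

theorem of_isPushout {w P : E} (hi : IsInflation i) {f : x ⟶ w} {a : w ⟶ P} {b : y ⟶ P}
    (sq : IsPushout f i a b) : IsConflation (biprod.lift f (-i)) (biprod.desc a b) :=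
  of_isInflation (hi.biprod_lift_neg f) sq.isColimitCokernelCofork

theorem isPullback {i' : x ⟶ y'} (h : IsConflation i p) (h' : IsConflation i' p') {g : y ⟶ y'}
    {k : z ⟶ z'} (hi : i ≫ g = i') (hp : g ≫ p' = p ≫ k) : IsPullback g p p' k := by
  have := h'.mono
  have eq_zero {t : E} (m : t ⟶ y) (hg : m ≫ g = 0) (hp : m ≫ p = 0) : m = 0 := by
    obtain ⟨n, rfl⟩ := h.exists_lift m hp
    rw [Category.assoc, hi] at hg
    rw [zero_of_comp_mono i' hg, zero_comp]
  have exists_lift (s : PullbackCone p' k) : ∃ m : s.pt ⟶ y, m ≫ g = s.fst ∧ m ≫ p = s.snd := by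
    obtain ⟨t, v, q, sq, -⟩ := ExactCategory.pullback_deflation p s.snd h.isDeflation
    obtain ⟨_, hq, -⟩ := h.exists_of_isPullback sq
    have := hq.epi
    obtain ⟨n, hn⟩ := h'.exists_lift (v ≫ g - q ≫ s.fst) (by
      rw [Preadditive.sub_comp, Category.assoc, Category.assoc, hp, sq.w_assoc, s.condition,
        sub_self])
    have hg : (v - n ≫ i) ≫ g = q ≫ s.fst := by
      rw [Preadditive.sub_comp, Category.assoc, hi, hn, sub_sub_cancel]
    have hp : (v - n ≫ i) ≫ p = q ≫ s.snd := by
      rw [Preadditive.sub_comp, Category.assoc, h.zero, comp_zero, sub_zero, sq.w]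
    obtain ⟨m, hm⟩ := hq.exists_desc (v - n ≫ i) (eq_zero _
      (by rw [Category.assoc, hg, reassoc_of% hq.zero, zero_comp])
      (by rw [Category.assoc, hp, reassoc_of% hq.zero, zero_comp]))
    exact ⟨m, by rw [← cancel_epi q, reassoc_of% hm, hg],
      by rw [← cancel_epi q, reassoc_of% hm, hp]⟩
  choose lift hlift using exists_lift
  refine ⟨⟨hp⟩, ⟨PullbackCone.IsLimit.mk _ lift (fun s => (hlift s).1) (fun s => (hlift s).2)
    fun s m hm₁ hm₂ => ?_⟩⟩
  exact sub_eq_zero.1 (eq_zero _ (by rw [Preadditive.sub_comp, hm₁, (hlift s).1, sub_self])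
    (by rw [Preadditive.sub_comp, hm₂, (hlift s).2, sub_self]))

theorem isPushout {f : y ⟶ y'} {k : z ⟶ z'} (h : IsConflation i p)
    (h' : IsConflation (i ≫ f) p') (w : f ≫ p' = p ≫ k) : IsPushout f p p' k := by
  have := h.epi
  have := h'.epi
  have exists_desc (s : PushoutCocone f p) : ∃ m : z' ⟶ s.pt, p' ≫ m = s.inl :=
    h'.exists_desc s.inl (by rw [Category.assoc, s.condition, reassoc_of% h.zero, zero_comp])
  choose desc hdesc using exists_desc
  refine ⟨⟨w⟩, ⟨PushoutCocone.IsColimit.mk _ desc hdesc (fun s => ?_) fun s m hm _ => ?_⟩⟩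
  · rw [← cancel_epi p, ← reassoc_of% w, hdesc, s.condition]
  · rw [← cancel_epi p', hm, hdesc]

theorem of_isPullback {g : y ⟶ y'} {k : z ⟶ z'} {w : E} {k' : z' ⟶ w}
    (sq : IsPullback g p p' k) (hp' : IsDeflation p') (hk : IsConflation k k') :
    IsConflation g (p' ≫ k') := by
  have := hk.mono
  have : Mono g := sq.mono_fst_of_mono
  refine of_isDeflation (hp'.comp hk.isDeflation)
    (w := by rw [sq.w_assoc, hk.zero, comp_zero]) (KernelFork.IsLimit.ofι' _ _ fun f hf => ?_)
  have hl := hk.exists_lift (f ≫ p') (by rw [Category.assoc, hf])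
  exact ⟨sq.lift f hl.choose hl.choose_spec.symm, sq.lift_fst _ _ _⟩

theorem three_by_three {x'' y'' z'' : E} {i'' : x'' ⟶ y''} {p'' : y'' ⟶ z''}
    {a : x ⟶ x'} {a' : x' ⟶ x''} {b : y ⟶ y'} {b' : y' ⟶ y''} {c : z ⟶ z'} {c' : z' ⟶ z''}
    (h : IsConflation i p) (h' : IsConflation i' p')
    (ha : IsConflation a a') (hb : IsConflation b b') (hc : IsConflation c c')
    (w₁ : a ≫ i' = i ≫ b) (w₂ : b ≫ p' = p ≫ c)
    (w₃ : a' ≫ i'' = i' ≫ b') (w₄ : b' ≫ p'' = p' ≫ c') : IsConflation i'' p'' := by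
  have := hb.epi
  -- The morphism of conflations `(a, b, c)` factors through the conflation `x' ⟶ P ⟶ z` obtained
  -- from `(i, p)` by pushout along `a`; the cokernel of `e : P ⟶ y'` is that of `c`, and dividing
  -- `P ⟶ y' ⟶ z''` by `y` gives the third row.
  obtain ⟨P, d, j, sq, -⟩ := ExactCategory.pushout_inflation i a h.isInflation
  obtain ⟨q, hq, hdq⟩ := h.exists_of_isPushout sq
  obtain ⟨r, hr, hjr⟩ := ha.exists_of_isPushout sq.flip
  have hjb : j ≫ sq.desc i' b w₁ = i' := sq.inl_desc _ _ _
  have hdb : d ≫ sq.desc i' b w₁ = b := sq.inr_desc _ _ _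
  generalize sq.desc i' b w₁ = e at hjb hdb
  have hep : e ≫ p' = q ≫ c := sq.hom_ext
    (by rw [reassoc_of% hjb, h'.zero, reassoc_of% hq.zero, zero_comp])
    (by rw [reassoc_of% hdb, w₂, reassoc_of% hdq])
  have heb : e ≫ b' = r ≫ i'' := sq.hom_ext
    (by rw [reassoc_of% hjb, reassoc_of% hjr, w₃])
    (by rw [reassoc_of% hdb, hb.zero, reassoc_of% hr.zero, zero_comp])
  have he : IsConflation e (p' ≫ c') := of_isPullback (hq.isPullback h' hjb hep) h'.isDeflation hc
  obtain ⟨s, hs, hbs⟩ := he.exists_of_isPushout (hr.isPushout (hdb.symm ▸ hb) heb).flip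
  rwa [← cancel_epi b' |>.1 (hbs.trans w₄.symm)]

end IsConflation
end ExactCategory

open MonoidalLeftAction

variable {E : Type*} [Category E] [Preadditive E] [HasZeroObject E] [HasBinaryBiproducts E]
  [ExactCategory E] [ComplicialExactCategory E]

/-! ### The action and the inflations `x ⟶ C ⊗ x` -/

theorem actionHomLeft_sub {a b : ChbZ} (f g : a ⟶ b) (x : E) :
    (f - g) ⊵ₗ x = f ⊵ₗ x - g ⊵ₗ x :=
  (actionRight ChbZ x).map_sub

theorem isZero_action (a : ChbZ) {x : E} (hx : IsZero x) : IsZero (a ⊙ₗ x : E) :=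
  (actionLeft E a).map_isZero hx

theorem IsConflation.action (a : ChbZ) {x y z : E} {i : x ⟶ y} {p : y ⟶ z}
    (h : IsConflation i p) : IsConflation (a ⊴ₗ i) (a ⊴ₗ p) :=
  .of_shortComplex (ComplicialExactCategory.conflation_actionLeft a _ h.2)

theorem isConflation_toC (x : E) : IsConflation (toC x) (cToT ⊵ₗ x) := by
  have h : IsConflation (unitToC ⊵ₗ x) (cToT ⊵ₗ x) := .of_shortComplex
    (ComplicialExactCategory.conflation_actionRight x unitCT degreewiseSplit_unitCT)
  exact h.of_iso (λₗ[ChbZ] x) (Iso.refl _) (Iso.refl _) (by simp [toC]) (by simp)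

theorem toC_naturality {x y : E} (f : x ⟶ y) : toC x ≫ C ⊴ₗ f = f ≫ toC y := by
  simp only [toC, Category.assoc]
  rw [← action_exchange, actionUnitIso_inv_naturality_assoc]

theorem toC_action (a : ChbZ) (x : E) :
    toC (a ⊙ₗ x) = ((λ_ a).inv ≫ unitToC ▷ a) ⊵ₗ x ≫ (αₗ C a x).hom := by
  have h : (λ_ a).inv ⊵ₗ x = (λₗ[ChbZ] (a ⊙ₗ x)).inv ≫ (αₗ (𝟙_ ChbZ) a x).inv := by
    rw [← cancel_epi ((λ_ a).hom ⊵ₗ x), hom_inv_actionHomLeft, leftUnitor_actionHom]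
    simp
  rw [toC, comp_actionHomLeft, h, whiskerRight_actionHomLeft]
  simp only [Category.assoc, Iso.inv_hom_id, Iso.inv_hom_id_assoc, Category.comp_id]

theorem exists_toC_comp_eq_actionHomLeft {a b : ChbZ} {f : a ⟶ b} (H : Homotopy f.hom 0)
    (x : E) : ∃ g : C ⊙ₗ (a ⊙ₗ x) ⟶ b ⊙ₗ x, toC (a ⊙ₗ x) ≫ g = f ⊵ₗ x := by
  obtain ⟨g, hg⟩ := exists_unitToC_whiskerRight_comp_eq H
  refine ⟨(αₗ C a x).inv ≫ g ⊵ₗ x, ?_⟩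
  rw [toC_action, Category.assoc, Iso.hom_inv_id_assoc, ← comp_actionHomLeft, Category.assoc, hg,
    Iso.inv_hom_id_assoc]

theorem exists_retraction_toC (u : E) :
    ∃ g : C ⊙ₗ (C ⊙ₗ u) ⟶ (C ⊙ₗ u : E), toC (C ⊙ₗ u : E) ≫ g = 𝟙 _ := by
  obtain ⟨g, hg⟩ := exists_toC_comp_eq_actionHomLeft (f := 𝟙 C) homotopyIdComplexC u
  exact ⟨g, hg.trans (id_actionHomLeft _ _)⟩

/-! ### Frobenius inflations and projective-injective objects -/

theorem isFrobeniusInflation_toC (x : E) : IsFrobeniusInflation (toC x) := by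
  refine ⟨isInflation_toC x, fun u f => ?_⟩
  obtain ⟨g, hg⟩ := exists_retraction_toC u
  exact ⟨C ⊴ₗ f ≫ g, by rw [reassoc_of% toC_naturality f, hg, Category.comp_id]⟩

theorem IsFrobeniusInflation.of_isPushout {x y x' y' : E} {f : x ⟶ x'} {i : x ⟶ y} {i' : x' ⟶ y'}
    {f' : y ⟶ y'} (h : IsFrobeniusInflation i) (sq : IsPushout f i i' f') :
    IsFrobeniusInflation i' := by
  refine ⟨h.1.of_isPushout sq, fun u g => ?_⟩
  obtain ⟨k, hk⟩ := h.2 u (f ≫ g)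
  exact ⟨sq.desc g k hk.symm, sq.inl_desc _ _ _⟩

theorem IsFrobeniusInflation.comp {x y z : E} {i : x ⟶ y} {j : y ⟶ z}
    (hi : IsFrobeniusInflation i) (hj : IsFrobeniusInflation j) :
    IsFrobeniusInflation (i ≫ j) := by
  refine ⟨hi.1.comp hj.1, fun u f => ?_⟩
  obtain ⟨g, rfl⟩ := hi.2 u f
  obtain ⟨k, rfl⟩ := hj.2 u g
  exact ⟨k, Category.assoc _ _ _⟩

theorem IsFrobeniusInflation.biprod_lift_neg {x y z : E} {i : x ⟶ y}
    (hi : IsFrobeniusInflation i) (f : x ⟶ z) : IsFrobeniusInflation (biprod.lift f (-i)) := by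
  refine ⟨hi.1.biprod_lift_neg f, fun u g => ?_⟩
  obtain ⟨k, rfl⟩ := hi.2 u g
  exact ⟨biprod.snd ≫ (-k), by simp⟩

theorem isProjectiveInjective_C (u : E) : IsProjectiveInjective (C ⊙ₗ u : E) :=
  ⟨fun _ hp f => hp.2 u f, fun _ hi f => hi.2 u f⟩

theorem isProjectiveInjective_zero : IsProjectiveInjective (0 : E) :=
  ⟨fun _ _ _ => ⟨0, (isZero_zero E).eq_of_src _ _⟩,
    fun _ _ _ => ⟨0, (isZero_zero E).eq_of_tgt _ _⟩⟩

theorem isProjectiveInjective_biprod {q r : E} (hq : IsProjectiveInjective q)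
    (hr : IsProjectiveInjective r) : IsProjectiveInjective (q ⊞ r) := by
  refine ⟨fun p hp f => ?_, fun i hi f => ?_⟩
  · obtain ⟨g, hg⟩ := hq.1 p hp (biprod.inl ≫ f)
    obtain ⟨h, hh⟩ := hr.1 p hp (biprod.inr ≫ f)
    exact ⟨biprod.desc g h, by ext <;> simp [hg, hh]⟩
  · obtain ⟨g, hg⟩ := hq.2 i hi (f ≫ biprod.fst)
    obtain ⟨h, hh⟩ := hr.2 i hi (f ≫ biprod.snd)
    exact ⟨biprod.lift g h, by ext <;> simp [hg, hh]⟩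

/-! ### Homotopies -/

/-- A null-homotopic map: one that factors through a projective-injective object. -/
def IsNullHomotopic {x y : E} (f : x ⟶ y) : Prop :=
  ∃ q : E, IsProjectiveInjective q ∧ ∃ (a : x ⟶ q) (b : q ⟶ y), f = a ≫ b

theorem homotopic_iff {x y : E} {f g : x ⟶ y} : Homotopic f g ↔ IsNullHomotopic (f - g) :=
  Iff.rfl

theorem Homotopic.refl {x y : E} (f : x ⟶ y) : Homotopic f f :=
  ⟨0, isProjectiveInjective_zero, 0, 0, by simp⟩

namespace IsNullHomotopic

variable {x y z : E}

theorem of_C {u : E} (a : x ⟶ C ⊙ₗ u) (b : C ⊙ₗ u ⟶ y) : IsNullHomotopic (a ≫ b) :=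
  ⟨_, isProjectiveInjective_C u, a, b, rfl⟩

theorem add {f g : x ⟶ y} (hf : IsNullHomotopic f) (hg : IsNullHomotopic g) :
    IsNullHomotopic (f + g) := by
  obtain ⟨q, hq, a, b, rfl⟩ := hf
  obtain ⟨r, hr, c, d, rfl⟩ := hg
  exact ⟨q ⊞ r, isProjectiveInjective_biprod hq hr, biprod.lift a c, biprod.desc b d, by simp⟩

theorem neg {f : x ⟶ y} (hf : IsNullHomotopic f) : IsNullHomotopic (-f) := by
  obtain ⟨q, hq, a, b, rfl⟩ := hf
  exact ⟨q, hq, -a, b, by simp⟩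

theorem comp_left {g : y ⟶ z} (hg : IsNullHomotopic g) (f : x ⟶ y) :
    IsNullHomotopic (f ≫ g) := by
  obtain ⟨q, hq, a, b, rfl⟩ := hg
  exact ⟨q, hq, f ≫ a, b, by simp⟩

theorem comp_right {f : x ⟶ y} (hf : IsNullHomotopic f) (g : y ⟶ z) :
    IsNullHomotopic (f ≫ g) := by
  obtain ⟨q, hq, a, b, rfl⟩ := hf
  exact ⟨q, hq, a, b ≫ g, by simp⟩

theorem exists_toC_comp_eq {f : x ⟶ y} (hf : IsNullHomotopic f) :
    ∃ h : C ⊙ₗ x ⟶ y, toC x ≫ h = f := by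
  obtain ⟨q, hq, a, b, rfl⟩ := hf
  obtain ⟨g, hg⟩ := hq.2 (toC x) (isFrobeniusInflation_toC x) a
  exact ⟨g ≫ b, by rw [← Category.assoc, hg]⟩

end IsNullHomotopic

theorem isNullHomotopic_id_C (u : E) : IsNullHomotopic (𝟙 (C ⊙ₗ u : E)) := by
  simpa only [Category.comp_id] using IsNullHomotopic.of_C (𝟙 (C ⊙ₗ u : E)) (𝟙 _)

theorem Homotopic.actionHomLeft {a b : ChbZ} {f g : a ⟶ b} (H : Homotopy f.hom g.hom) (x : E) :
    Homotopic (f ⊵ₗ x) (g ⊵ₗ x) := by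
  obtain ⟨k, hk⟩ := exists_toC_comp_eq_actionHomLeft (f := f - g) (Homotopy.equivSubZero H) x
  rw [homotopic_iff, ← actionHomLeft_sub, ← hk]
  exact .of_C _ _

theorem homotopyEquivalences_of_isIso {x y : E} (f : x ⟶ y) [IsIso f] :
    homotopyEquivalences E f :=
  ⟨inv f, by rw [IsIso.hom_inv_id]; exact .refl _, by rw [IsIso.inv_hom_id]; exact .refl _⟩

theorem homotopyEquivalences_actionHomLeft {a b : ChbZ} {f : a ⟶ b}
    (hf : chHomotopyEquivalences f) (x : E) : homotopyEquivalences E (f ⊵ₗ x) := by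
  obtain ⟨e, he⟩ := hf
  let g : b ⟶ a := ObjectProperty.homMk e.inv
  refine ⟨g ⊵ₗ x, ?_, ?_⟩
  · rw [← comp_actionHomLeft, ← id_actionHomLeft]
    exact .actionHomLeft (f := f ≫ g) (g := 𝟙 a)
      ((Homotopy.ofEq (by simp [g, he])).trans e.homotopyHomInvId) x
  · rw [← comp_actionHomLeft, ← id_actionHomLeft]
    exact .actionHomLeft (f := g ≫ f) (g := 𝟙 b)
      ((Homotopy.ofEq (by simp [g, he])).trans e.homotopyInvHomId) x

theorem homotopyEquivalences_of_isNullHomotopic_id {x y : E} (hx : IsNullHomotopic (𝟙 x))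
    (hy : IsNullHomotopic (𝟙 y)) (f : x ⟶ y) : homotopyEquivalences E f :=
  ⟨0, by rw [homotopic_iff, comp_zero, zero_sub]; exact hx.neg,
    by rw [homotopic_iff, zero_comp, zero_sub]; exact hy.neg⟩

theorem homotopyEquivalences_biprod_fst (x u : E) :
    homotopyEquivalences E (biprod.fst : x ⊞ C ⊙ₗ u ⟶ x) := by
  refine ⟨biprod.inl, ?_, by rw [biprod.inl_fst]; exact .refl _⟩
  rw [homotopic_iff, ← biprod.total, sub_add_cancel_left]
  exact (IsNullHomotopic.of_C _ _).neg

theorem exists_homotopyEquivalence_of_isPushout {y z I I' P P' : E} {g : y ⟶ z} {j : y ⟶ I}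
    {j' : y ⟶ I'} {a : z ⟶ P} {b : I ⟶ P} {a' : z ⟶ P'} {b' : I' ⟶ P'} (sq : IsPushout g j a b)
    (sq' : IsPushout g j' a' b') (hj : IsFrobeniusInflation j) (hj' : IsFrobeniusInflation j')
    (hI : IsProjectiveInjective I) (hI' : IsProjectiveInjective I') :
    ∃ e : P ⟶ P', homotopyEquivalences E e := by
  obtain ⟨u, hu⟩ := hI'.2 j hj j'
  obtain ⟨v, hv⟩ := hI.2 j' hj' j
  have w : g ≫ a' = j ≫ u ≫ b' := by rw [sq'.w, reassoc_of% hu]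
  have w' : g ≫ a = j' ≫ v ≫ b := by rw [sq.w, reassoc_of% hv]
  have huv : g ≫ 0 = j ≫ (u ≫ v - 𝟙 I) := by
    rw [comp_zero, Preadditive.comp_sub, reassoc_of% hu, hv, Category.comp_id, sub_self]
  have hvu : g ≫ 0 = j' ≫ (v ≫ u - 𝟙 I') := by
    rw [comp_zero, Preadditive.comp_sub, reassoc_of% hv, hu, Category.comp_id, sub_self]
  refine ⟨sq.desc a' (u ≫ b') w, sq'.desc a (v ≫ b) w',
    ⟨I, hI, sq.desc 0 (u ≫ v - 𝟙 I) huv, b, sq.hom_ext ?_ ?_⟩,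
    ⟨I', hI', sq'.desc 0 (v ≫ u - 𝟙 I') hvu, b', sq'.hom_ext ?_ ?_⟩⟩ <;>
  simp

/-! ### Cones -/

/-- The structure map `y ⟶ cone f` of the cone of `f : x ⟶ y`. -/
def coneInl {x y : E} (f : x ⟶ y) : y ⟶ cone f := pushout.inl _ _

/-- The structure map `C ⊗ x ⟶ cone f` of the cone of `f : x ⟶ y`. -/
def coneInr {x y : E} (f : x ⟶ y) : C ⊙ₗ x ⟶ cone f := pushout.inr _ _

theorem isPushout_cone {x y : E} (f : x ⟶ y) :
    IsPushout f (toC x) (coneInl f) (coneInr f) :=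
  IsPushout.of_hasPushout f (toC x)

theorem isConflation_cone {x y : E} (f : x ⟶ y) :
    IsConflation (biprod.lift f (-toC x)) (biprod.desc (coneInl f) (coneInr f)) :=
  .of_isPushout (isInflation_toC x) (isPushout_cone f)

theorem isFrobeniusInflation_coneInl {x y : E} (f : x ⟶ y) : IsFrobeniusInflation (coneInl f) :=
  (isFrobeniusInflation_toC x).of_isPushout (isPushout_cone f)

theorem exists_isConflation_coneInl {x y : E} (f : x ⟶ y) :
    ∃ p : cone f ⟶ T ⊙ₗ x, IsConflation (coneInl f) p ∧ coneInr f ≫ p = cToT ⊵ₗ x :=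
  (isConflation_toC x).exists_of_isPushout (isPushout_cone f)

theorem IsConflation.exists_isConflation_coneInr {x y z : E} {i : x ⟶ y} {p : y ⟶ z}
    (h : IsConflation i p) : ∃ p' : cone i ⟶ z, IsConflation (coneInr i) p' :=
  (h.exists_of_isPushout (isPushout_cone i).flip).imp fun _ h => h.1

/-- The map `cone f ⟶ cone f'` induced by a commutative square from `f` to `f'`. -/
def coneMap {x y x' y' : E} {f : x ⟶ y} {f' : x' ⟶ y'} (a : x ⟶ x') (b : y ⟶ y')
    (w : f ≫ b = a ≫ f') : cone f ⟶ cone f' :=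
  (isPushout_cone f).desc (b ≫ coneInl f') (C ⊴ₗ a ≫ coneInr f') (by
    rw [reassoc_of% w, (isPushout_cone f').w, reassoc_of% toC_naturality a])

section

variable {x y x' y' x'' y'' : E} {f : x ⟶ y} {f' : x' ⟶ y'} {f'' : x'' ⟶ y''}

theorem coneInl_coneMap (a : x ⟶ x') (b : y ⟶ y') (w : f ≫ b = a ≫ f') :
    coneInl f ≫ coneMap a b w = b ≫ coneInl f' :=
  (isPushout_cone f).inl_desc _ _ _

theorem coneInr_coneMap (a : x ⟶ x') (b : y ⟶ y') (w : f ≫ b = a ≫ f') :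
    coneInr f ≫ coneMap a b w = C ⊴ₗ a ≫ coneInr f' :=
  (isPushout_cone f).inr_desc _ _ _

theorem coneMap_comp (a : x ⟶ x') (b : y ⟶ y') (w : f ≫ b = a ≫ f') (a' : x' ⟶ x'')
    (b' : y' ⟶ y'') (w' : f' ≫ b' = a' ≫ f'') :
    coneMap a b w ≫ coneMap a' b' w' =
      coneMap (a ≫ a') (b ≫ b') (by rw [reassoc_of% w, w', Category.assoc]) := by
  refine (isPushout_cone f).hom_ext ?_ ?_
  · rw [reassoc_of% coneInl_coneMap a b w, coneInl_coneMap, coneInl_coneMap, Category.assoc]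
  · rw [reassoc_of% coneInr_coneMap a b w, coneInr_coneMap, coneInr_coneMap, actionHomRight_comp,
      Category.assoc]

theorem coneMap_id (f : x ⟶ y) :
    coneMap (f := f) (f' := f) (𝟙 x) (𝟙 y) (by simp) = 𝟙 (cone f) :=
  (isPushout_cone f).hom_ext (by simp [coneInl_coneMap]) (by simp [coneInr_coneMap])

end

theorem isPushout_coneMap {x y z : E} (f : x ⟶ y) (g : y ⟶ z) :
    IsPushout g (coneInl f) (coneInl (f ≫ g))
      (coneMap (f' := f ≫ g) (𝟙 x) g (Category.id_comp _).symm) := by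
  refine IsPushout.of_left (h₁₁ := f) (v₁₁ := toC x) (h₂₁ := coneInr f) ?_
    (coneInl_coneMap _ _ _).symm (isPushout_cone f)
  rw [coneInr_coneMap, actionHomRight_id, Category.id_comp]
  exact isPushout_cone (f ≫ g)

theorem IsConflation.isConflation_coneMap {x y z x' y' z' : E} {i : x ⟶ y} {p : y ⟶ z}
    {i' : x' ⟶ y'} {p' : y' ⟶ z'} (h : IsConflation i p) (h' : IsConflation i' p')
    {a : x ⟶ x'} {b : y ⟶ y'} {c : z ⟶ z'} (w₁ : a ≫ i' = i ≫ b) (w₂ : b ≫ p' = p ≫ c) :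
    IsConflation (coneMap i i' w₁) (coneMap p p' w₂) :=
  h.three_by_three (h'.biprod_map (h.action C)) (isConflation_cone a) (isConflation_cone b)
    (isConflation_cone c) (by ext <;> simp [w₁, toC_naturality])
    (by ext <;> simp [w₂, toC_naturality])
    (by ext <;> simp [coneInl_coneMap, coneInr_coneMap])
    (by ext <;> simp [coneInl_coneMap, coneInr_coneMap])

theorem isNullHomotopic_coneInl {x y : E} {f : x ⟶ y} (hf : homotopyEquivalences E f) :
    IsNullHomotopic (coneInl f) := by
  obtain ⟨g, -, hg⟩ := hf
  have hgf : IsNullHomotopic (g ≫ f ≫ coneInl f) := by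
    rw [(isPushout_cone f).w, ← Category.assoc]
    exact .of_C _ _
  have := hgf.add ((homotopic_iff.1 hg).comp_right (coneInl f)).neg
  rwa [Preadditive.sub_comp, Category.assoc, Category.id_comp, neg_sub, add_sub_cancel] at this

theorem isNullHomotopic_id_cone {x y : E} {f : x ⟶ y} (hf : homotopyEquivalences E f) :
    IsNullHomotopic (𝟙 (cone f)) := by
  have hn := isNullHomotopic_coneInl hf
  obtain ⟨g, hfg, -⟩ := hf
  obtain ⟨h, hh⟩ := (homotopic_iff.1 hfg).exists_toC_comp_eq
  have hr : biprod.lift f (-toC x) ≫ biprod.desc g h = 𝟙 x := by simp [hh]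
  obtain ⟨s, hs⟩ := (isConflation_cone f).exists_section hr
  rw [← hs, biprod.desc_eq, Preadditive.comp_add, ← Category.assoc, ← Category.assoc]
  exact (hn.comp_left _).add (.of_C _ _)

/-! ### Null classes -/

namespace IsNullClass

variable {N : ObjectProperty E}

theorem prop_middle_of_isConflation (hN : IsNullClass N) {x y z : E} {i : x ⟶ y} {p : y ⟶ z}
    (h : IsConflation i p) (hx : N x) (hz : N z) : N y :=
  hN.extension h.2 hx hz

theorem of_isNullHomotopic_id (hN : IsNullClass N) {x : E} (hx : IsNullHomotopic (𝟙 x)) : N x :=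
  have h₀ : IsNullHomotopic (𝟙 (0 : E)) := by
    rw [(isZero_zero E).eq_of_src (𝟙 0) (0 - 0)]; exact Homotopic.refl 0
  hN.homotopyEquivalent 0 (homotopyEquivalences_of_isNullHomotopic_id h₀ hx 0) hN.zero

theorem prop_C (hN : IsNullClass N) (u : E) : N (C ⊙ₗ u) :=
  hN.of_isNullHomotopic_id (isNullHomotopic_id_C u)

theorem of_T (hN : IsNullClass N) {x : E} (h : N (T ⊙ₗ x)) : N x := by
  refine hN.retract ((λₗ[ChbZ] x).inv ≫ unitRetract.i ⊵ₗ x ≫ (αₗ TInv T x).hom)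
    ((αₗ TInv T x).inv ≫ unitRetract.r ⊵ₗ x ≫ (λₗ[ChbZ] x).hom) ?_ (hN.tensor TInv h)
  rw [Category.assoc, Category.assoc, Iso.hom_inv_id_assoc, ← comp_actionHomLeft_assoc,
    unitRetract.retract, id_actionHomLeft, Category.id_comp, Iso.inv_hom_id]

theorem coneIn_of_isConflation (hN : IsNullClass N) {x y z : E} {i : x ⟶ y} {p : y ⟶ z}
    (h : IsConflation i p) (hz : N z) : coneIn N i := by
  obtain ⟨p', h'⟩ := h.exists_isConflation_coneInr
  exact hN.prop_middle_of_isConflation h' (hN.prop_C x) hz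

theorem prop_right_of_isConflation (hN : IsNullClass N) {x y z : E} {i : x ⟶ y} {p : y ⟶ z}
    (h : IsConflation i p) (hi : IsFrobeniusInflation i) (hx : N x) (hy : N y) : N z := by
  obtain ⟨p', h'⟩ := h.exists_isConflation_coneInr
  obtain ⟨q, hq, -⟩ := exists_isConflation_coneInl i
  obtain ⟨r, hr⟩ := (hi.of_isPushout (isPushout_cone i).flip).2 x (𝟙 _)
  obtain ⟨s, hs⟩ := h'.exists_section hr
  exact hN.retract s p' hs (hN.prop_middle_of_isConflation hq hy (hN.tensor T hx))

theorem prop_left_of_isConflation (hN : IsNullClass N) {x y z : E} {i : x ⟶ y} {p : y ⟶ z}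
    (h : IsConflation i p) (hy : N y) (hz : N z) : N x := by
  obtain ⟨q, hq, -⟩ := exists_isConflation_coneInl i
  exact hN.of_T (hN.prop_right_of_isConflation hq (isFrobeniusInflation_coneInl i) hy
    (hN.coneIn_of_isConflation h hz))

theorem prop_iff_of_homotopyEquivalences (hN : IsNullClass N) {x y : E} {f : x ⟶ y}
    (hf : homotopyEquivalences E f) : N x ↔ N y :=
  have ⟨g, hfg, hgf⟩ := hf
  ⟨hN.homotopyEquivalent f hf, hN.homotopyEquivalent g ⟨f, hgf, hfg⟩⟩

theorem exists_octahedron (hN : IsNullClass N) {x y z : E} (f : x ⟶ y) (g : y ⟶ z) :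
    ∃ (u v : E) (i : cone f ⟶ u) (p : u ⟶ v), IsConflation i p ∧ IsFrobeniusInflation i ∧
      (N u ↔ N (cone (f ≫ g))) ∧ (N v ↔ N (cone g)) := by
  let k : cone f ⟶ cone (f ≫ g) := coneMap (𝟙 x) g (Category.id_comp _).symm
  -- `cone k` is a pushout of `g` along `y ⟶ cone f ⟶ C ⊗ cone f`, while `cone g` is its pushout
  -- along `y ⟶ C ⊗ y`.
  have sq := (isPushout_coneMap f g).paste_vert (isPushout_cone k)
  obtain ⟨e, he⟩ := exists_homotopyEquivalence_of_isPushout sq (isPushout_cone g)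
    ((isFrobeniusInflation_coneInl f).comp (isFrobeniusInflation_toC _))
    (isFrobeniusInflation_toC y) (isProjectiveInjective_C _) (isProjectiveInjective_C _)
  exact ⟨_, _, _, _, isConflation_cone k, (isFrobeniusInflation_toC _).biprod_lift_neg k,
    hN.prop_iff_of_homotopyEquivalences (homotopyEquivalences_biprod_fst _ _),
    hN.prop_iff_of_homotopyEquivalences he⟩

theorem hasTwoOutOfThreeProperty (hN : IsNullClass N) :
    (coneIn N).HasTwoOutOfThreeProperty where
  comp_mem f g hf hg := by
    obtain ⟨u, v, i, p, h, -, hu, hv⟩ := hN.exists_octahedron f g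
    exact hu.1 (hN.prop_middle_of_isConflation h hf (hv.2 hg))
  of_postcomp f g hg hfg := by
    obtain ⟨u, v, i, p, h, -, hu, hv⟩ := hN.exists_octahedron f g
    exact hN.prop_left_of_isConflation h (hu.2 hfg) (hv.2 hg)
  of_precomp f g hf hfg := by
    obtain ⟨u, v, i, p, h, hi, hu, hv⟩ := hN.exists_octahedron f g
    exact hv.1 (hN.prop_right_of_isConflation h hi hf (hu.2 hfg))

theorem homotopyEquivalences_le_coneIn (hN : IsNullClass N) :
    homotopyEquivalences E ≤ coneIn N :=
  fun _ _ _ hf => hN.of_isNullHomotopic_id (isNullHomotopic_id_cone hf)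

theorem coneIn_actionHomRight (hN : IsNullClass N) (a : ChbZ) {x y : E} {g : x ⟶ y}
    (hg : coneIn N g) : coneIn N (a ⊴ₗ g) := by
  have := hN.hasTwoOutOfThreeProperty
  have h_lift : coneIn N (a ⊴ₗ biprod.lift g (-toC x)) :=
    hN.coneIn_of_isConflation ((isConflation_cone g).action a) (hN.tensor a hg)
  have h_inl : coneIn N (a ⊴ₗ (biprod.inl : y ⟶ y ⊞ C ⊙ₗ x)) :=
    hN.coneIn_of_isConflation ((IsConflation.inl_snd y (C ⊙ₗ x)).action a)
      (hN.tensor a (hN.prop_C x))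
  have h_fst : coneIn N (a ⊴ₗ (biprod.fst : y ⊞ C ⊙ₗ x ⟶ y)) := by
    refine (coneIn N).of_precomp _ _ h_inl ?_
    rw [← actionHomRight_comp, biprod.inl_fst]
    exact hN.homotopyEquivalences_le_coneIn _ (homotopyEquivalences_of_isIso _)
  have h := (coneIn N).comp_mem _ _ h_lift h_fst
  rwa [← actionHomRight_comp, biprod.lift_fst] at h

theorem coneIn_isStableUnderRetracts (hN : IsNullClass N) :
    (coneIn N).IsStableUnderRetracts where
  of_retract {_ _ _ _ f g} h hg := by
    refine hN.retract (coneMap (f := f) (f' := g) h.i.left h.i.right h.i_w.symm)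
      (coneMap h.r.left h.r.right h.r_w.symm) ?_ hg
    rw [coneMap_comp, ← coneMap_id]
    congr 1
    · exact h.retract_left
    · exact h.retract_right

theorem coneIn_isClassOfWeakEquivalences (hN : IsNullClass N) :
    IsClassOfWeakEquivalences (coneIn N) where
  tensor {a b x y} f g hf hg := by
    have := hN.hasTwoOutOfThreeProperty
    rw [actionHom_def]
    exact (coneIn N).comp_mem _ _
      (hN.homotopyEquivalences_le_coneIn _ (homotopyEquivalences_actionHomLeft hf x))
      (hN.coneIn_actionHomRight b hg)
  homotopyEquivalences_le := hN.homotopyEquivalences_le_coneIn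
  twoOutOfThree := hN.hasTwoOutOfThreeProperty
  extension φ h h' := hN.prop_middle_of_isConflation
    ((IsConflation.of_shortComplex h).isConflation_coneMap (.of_shortComplex h')
      φ.comm₁₂ φ.comm₂₃)
  retract := hN.coneIn_isStableUnderRetracts

theorem trivialObjects_coneIn (hN : IsNullClass N) : trivialObjects (coneIn N) = N := by
  ext x
  obtain ⟨p, hp, -⟩ := exists_isConflation_coneInl (0 : (0 : E) ⟶ x)
  have hT : N (T ⊙ₗ (0 : E)) := hN.tensor T hN.zero
  exact ⟨fun h => hN.prop_left_of_isConflation hp h hT,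
    fun h => hN.prop_middle_of_isConflation hp h hT⟩

end IsNullClass

/-! ### Classes of weak equivalences -/

namespace IsClassOfWeakEquivalences

variable {w : MorphismProperty E}

theorem of_isIso (hw : IsClassOfWeakEquivalences w) {x y : E} (f : x ⟶ y) [IsIso f] : w f :=
  hw.homotopyEquivalences_le _ (homotopyEquivalences_of_isIso f)

theorem of_isZero (hw : IsClassOfWeakEquivalences w) {x y : E} (f : x ⟶ y) (hx : IsZero x)
    (hy : IsZero y) : w f :=
  have : IsIso f := ⟨0, hx.eq_of_src _ _, hy.eq_of_src _ _⟩
  hw.of_isIso f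

theorem of_isConflation (hw : IsClassOfWeakEquivalences w) {x y z x' y' z' : E} {i : x ⟶ y}
    {p : y ⟶ z} {i' : x' ⟶ y'} {p' : y' ⟶ z'} (h : IsConflation i p) (h' : IsConflation i' p')
    {a : x ⟶ x'} {b : y ⟶ y'} {c : z ⟶ z'} (w₁ : a ≫ i' = i ≫ b) (w₂ : b ≫ p' = p ≫ c)
    (ha : w a) (hc : w c) : w b :=
  hw.extension (S := ShortComplex.mk i p h.zero) (S' := ShortComplex.mk i' p' h'.zero)
    ⟨a, b, c, w₁, w₂⟩ h.2 h'.2 ha hc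

theorem trivialObjects_of_isConflation (hw : IsClassOfWeakEquivalences w) {x y z : E}
    {i : x ⟶ y} {p : y ⟶ z} (h : IsConflation i p) (hx : trivialObjects w x)
    (hz : trivialObjects w z) : trivialObjects w y :=
  hw.of_isConflation (IsConflation.id_zero 0 (isZero_zero E)) h (by simp) (by simp) hx hz

theorem trivialObjects_iff (hw : IsClassOfWeakEquivalences w) {x y : E} {f : x ⟶ y} (hf : w f) :
    trivialObjects w x ↔ trivialObjects w y := by
  have := hw.twoOutOfThree
  have h : trivialObjects w y ↔ w ((0 : 0 ⟶ x) ≫ f) := by rw [zero_comp, trivialObjects]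
  exact ⟨fun hx => h.2 (w.comp_mem _ _ hx hf), fun hy => w.of_postcomp _ f hf (h.1 hy)⟩

theorem trivialObjects_isNullClass (hw : IsClassOfWeakEquivalences w) :
    IsNullClass (trivialObjects w) where
  zero := hw.of_isZero _ (isZero_zero E) (isZero_zero E)
  biprod {x y} := hw.trivialObjects_of_isConflation (IsConflation.inl_snd x y)
  homotopyEquivalent f hf := (hw.trivialObjects_iff (hw.homotopyEquivalences_le _ hf)).1
  tensor a {x} hx := by
    have h := hw.tensor (𝟙 a) (0 : (0 : E) ⟶ x) ⟨HomotopyEquiv.refl _, rfl⟩ hx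
    exact (hw.trivialObjects_iff h).1
      (hw.of_isZero _ (isZero_zero E) (isZero_action a (isZero_zero E)))
  extension h := hw.trivialObjects_of_isConflation (.of_shortComplex h)
  retract {x y} i p hip hy := by
    have := hw.retract
    exact w.of_retract (f := (0 : (0 : E) ⟶ x)) (g := (0 : (0 : E) ⟶ y))
      { i := Arrow.homMk (𝟙 _) i (by simp)
        r := Arrow.homMk (𝟙 _) p (by simp)
        retract := by ext <;> simp [hip] } hy

theorem coneIn_trivialObjects (hw : IsClassOfWeakEquivalences w) :
    coneIn (trivialObjects w) = w := by
  have := hw.twoOutOfThree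
  ext x y f
  refine ⟨fun h => ?_, fun h => ?_⟩
  · have h_lift : w (biprod.lift f (-toC x)) :=
      hw.of_isConflation (IsConflation.id_zero x (isZero_zero E)) (isConflation_cone f)
        (by simp) (by simp [(isPushout_cone f).w]) (hw.of_isIso (𝟙 x)) h
    have h := w.comp_mem _ _ h_lift
      (hw.homotopyEquivalences_le _ (homotopyEquivalences_biprod_fst y x))
    rwa [biprod.lift_fst] at h
  · obtain ⟨p, hp, hp'⟩ := exists_isConflation_coneInl f
    have h_inr : w (coneInr f) := hw.of_isConflation (isConflation_toC x) hp
      (isPushout_cone f).w (by rw [hp', Category.comp_id]) h (hw.of_isIso (𝟙 _))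
    exact (hw.trivialObjects_iff h_inr).1 (hw.trivialObjects_isNullClass.prop_C x)

end IsClassOfWeakEquivalences

end Complicial

end

theorem mainTheorem4 {E : Type*} [Category E] [Preadditive E]
    [HasZeroObject E] [HasBinaryBiproducts E]
    [Complicial.ExactCategory E] [Complicial.ComplicialExactCategory E] :
    (∀ w : MorphismProperty E, Complicial.IsClassOfWeakEquivalences w →
      Complicial.IsNullClass (Complicial.trivialObjects w)) ∧
    (∀ N : ObjectProperty E, Complicial.IsNullClass N →
      Complicial.IsClassOfWeakEquivalences (Complicial.coneIn N)) ∧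
    (∀ w : MorphismProperty E, Complicial.IsClassOfWeakEquivalences w →
      Complicial.coneIn (Complicial.trivialObjects w) = w) ∧
    (∀ N : ObjectProperty E, Complicial.IsNullClass N →
      Complicial.trivialObjects (Complicial.coneIn N) = N) :=
  ⟨fun _ hw => hw.trivialObjects_isNullClass, fun _ hN => hN.coneIn_isClassOfWeakEquivalences,
    fun _ hw => hw.coneIn_trivialObjects, fun _ hN => hN.trivialObjects_coneIn⟩
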